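/- Let $2<\beta<3$, $w_0>0$ and $\lambda>0$ be constants. For integers $n,d\ge 1$, the standard geometric inhomogeneous random graph $G=\mathrm{GIRG}(n,\beta,w_0,d)$ is the following random graph on $n$ vertices. Each vertex $v$ independently receives a weight $w_v$ with the Pareto distribution $\Pr(w_v\le x)=1-(x/w_0)^{1-\beta}$ for $x\ge w_0$, and, independently, a position $\mathbf{x}_v$ that is uniformly distributed on the torus $\mathbb{T}^d=(\mathbb{R}/\mathbb{Z})^d$ with the distance $d(\mathbf{x},\mathbf{y})=\max_{1\le i\le d}|\mathbf{x}_i-\mathbf{y}_i|_C$, where $|\cdot|_C$ is the distance on the circle of circumference $1$. Two vertices $u\ne v$ are adjacent if and only if $$d(\mathbf{x}_u,\mathbf{x}_v)\le \frac12\left(\frac{\lambda w_uw_v}{n}\right)^{1/d}.$$ Let $K_k$ be the number of $k$-cliques of $G$ and let $\omega(G)$ be its clique number. **Theorem.** Let $d=d(n)=\omega(\log n)$, that is, $d(n)/\log n\to\infty$. Then $$\mathbb{E}[K_k]=n^{\frac k2(3-\beta)}\,\Theta(k)^{-k}\qquad\text{for all }3\le k\le n,$$ uniformly in $k$: there are constants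 $c_1,c_2>0$, depending only on $\beta,w_0,\lambda$, such that for all sufficiently large $n$ and all integers $k$ with $3\le k\le n$, $$n^{\frac k2(3-\beta)}(c_1k)^{-k}\le \mathbb{E}[K_k]\le n^{\frac k2(3-\beta)}(c_2k)^{-k}.$$ Moreover, $\omega(G)=\Theta(n^{(3-\beta)/2})$ asymptotically almost surely: there are constants $C_1,C_2>0$, depending only on $\beta,w_0,\lambda$, such that $$\Pr\left(C_1n^{(3-\beta)/2}\le\omega(G)\le C_2n^{(3-\beta)/2}\right)\longrightarrow 1\qquad(n\to\infty).$$ -/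

import Mathlib

open Filter Topology MeasureTheory ProbabilityTheory

noncomputable section

/-- Attributes of a vertex of a geometric inhomogeneous random graph: its weight, and its position on
the `d`-dimensional torus `(ℝ/ℤ)^d`. The distance that Mathlib puts on `Fin d → UnitAddCircle` is
`max_i |x_i - y_i|_C`, where `|·|_C` is the distance on the circle of circumference `1`. -/
abbrev GIRGVertex (d : ℕ) : Type := ℝ × (Fin d → UnitAddCircle)

/-- The law of one vertex: the weight has the Pareto distribution with density
`(β - 1) w₀^(β - 1) x^(-β)` on `[w₀, ∞)`, that is, `P(w ≤ x) = 1 - (x / w₀)^(1 - β)` for `x ≥ w₀`,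
and the position is independent of it and uniform on the torus. -/
def girgVertexLaw (β w₀ : ℝ) (d : ℕ) : Measure (GIRGVertex d) :=
  (paretoMeasure w₀ (β - 1)).prod volume

/-- The joint law of the `n` independent vertices. -/
def girgLaw (n : ℕ) (β w₀ : ℝ) (d : ℕ) : Measure (Fin n → GIRGVertex d) :=
  Measure.pi fun _ => girgVertexLaw β w₀ d

/-- The connection threshold `t_uv = (1/2) (lam * w_u * w_v / n)^(1/d)` of two vertices with weights
`a` and `b`. -/
def connectionThreshold (lam : ℝ) (n d : ℕ) (a b : ℝ) : ℝ :=
  1 / 2 * (lam * a * b / n) ^ (1 / (d : ℝ))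

/-- The standard GIRG as a function of the vertex attributes: distinct vertices are adjacent if and
only if their distance on the torus is at most their connection threshold. Under the probability
measure `girgLaw n β w₀ d` this is the random graph `GIRG(n, β, w₀, d)`. -/
def girgGraph (lam : ℝ) {n d : ℕ} (ω : Fin n → GIRGVertex d) : SimpleGraph (Fin n) where
  Adj u v := u ≠ v ∧ dist (ω u).2 (ω v).2 ≤ connectionThreshold lam n d (ω u).1 (ω v).1
  symm := ⟨fun u v h => ⟨h.1.symm, by
    have h2 := h.2
    rw [dist_comm, connectionThreshold, mul_right_comm lam] at h2
    exact h2⟩⟩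
  loopless := ⟨fun _ h => h.1 rfl⟩

/-- The number of `k`-cliques (complete subgraphs on `k` vertices) of a graph on `Fin n`. -/
def numCliques {n : ℕ} (G : SimpleGraph (Fin n)) (k : ℕ) : ℕ :=
  {s : Finset (Fin n) | G.IsNClique k s}.ncard

/-- The expected number of `k`-cliques of `GIRG(n, β, w₀, d)`. -/
def expectedCliques (lam β w₀ : ℝ) (n d k : ℕ) : ℝ :=
  ∫ ω, (numCliques (girgGraph lam ω) k : ℝ) ∂(girgLaw n β w₀ d)

end

/-!
Upper bound. A set of vertices is a clique if and only if its pairs are close in each of the `d`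
independent coordinates of the torus. In a single coordinate the events that two given vertices are
far apart are pairwise independent, so with `S` the sum of their probabilities a Bonferroni-type
inequality bounds the probability of no far pair by `1 - S + S ^ 2 / 2`. For boundedly many pairs
and `d ≥ D log n` the sum `S` is uniformly small, and the `d`-th power of the bound is at most
`∏ min 1 (u_i * u_j) ^ σ`, where `u_i = w_i / √(n / lam)` and `σ < 1` can be taken as close to `1`
as necessary: the pairs behave almost as if they were independent. An induction that adds the
vertices in the order of increasing weight bounds this product over pairs by a product over
vertices, `∏ min (u_i ^ a) (u_i ^ b)` with `b < β - 1 < a` and `σ = a - b / 2`; it is here that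
`β < 3` enters, as `σ < 1` has to exceed `(β - 1) / 2`. Integrating each factor against the Pareto
law yields `(C n ^ ((1 - β) / 2)) ^ k` for the probability that `k` given vertices form a clique.

Lower bound. Vertices of weight at least `√(n / lam)` are adjacent wherever they lie, since their
connection threshold is at least the diameter `1 / 2` of the torus. A vertex is that heavy with
probability of order `n ^ ((1 - β) / 2)`.

Summing over the `k`-sets of vertices gives the estimates for the expected number of cliques. For
the clique number, use the first moment of the number of cliques from above, and Chebyshev's
inequality for the number of heavy vertices from below.
-/

section EventCount

variable {Ω κ : Type*} {mΩ : MeasurableSpace Ω} {μ : Measure Ω} {E : Finset κ} {B : κ → Set Ω}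

theorem indepFun_indicator_one_of_indepSet {S T : Set Ω} (h : IndepSet S T μ) :
    IndepFun (S.indicator (1 : Ω → ℝ)) (T.indicator (1 : Ω → ℝ)) μ := by
  have comap_le (R : Set Ω) : MeasurableSpace.comap (R.indicator (1 : Ω → ℝ)) inferInstance ≤
      MeasurableSpace.generateFrom {R} := by
    rw [← measurable_iff_comap_le]
    let _ := MeasurableSpace.generateFrom {R}
    exact measurable_one.indicator (MeasurableSpace.measurableSet_generateFrom rfl)
  exact indep_of_indep_of_le_left (indep_of_indep_of_le_right h (comap_le T)) (comap_le S)

theorem memLp_indicator_one [IsFiniteMeasure μ] {S : Set Ω} (hS : MeasurableSet S)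
    (p : ENNReal) : MemLp (S.indicator (1 : Ω → ℝ)) p μ :=
  memLp_indicator_const p hS 1 (Or.inr (measure_ne_top μ S))

theorem variance_indicator_one_le [IsProbabilityMeasure μ] {S : Set Ω} (hS : MeasurableSet S) :
    Var[S.indicator (1 : Ω → ℝ); μ] ≤ μ.real S := by
  have sq_eq : S.indicator (1 : Ω → ℝ) ^ 2 = S.indicator 1 := by
    ext ω
    by_cases h : ω ∈ S <;> simp [h]
  calc Var[S.indicator (1 : Ω → ℝ); μ] ≤ μ[S.indicator (1 : Ω → ℝ) ^ 2] :=
        variance_le_expectation_sq (memLp_indicator_one hS 2).aestronglyMeasurable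
    _ = μ.real S := by rw [sq_eq, integral_indicator_one hS]

/-- The number of indices `e ∈ E` whose event `B e` occurs, as a real random variable. -/
noncomputable def eventCount (E : Finset κ) (B : κ → Set Ω) : Ω → ℝ :=
  ∑ e ∈ E, (B e).indicator 1

theorem eventCount_eq_card (E : Finset κ) (B : κ → Set Ω) (ω : Ω) [DecidablePred fun e => ω ∈ B e] :
    eventCount E B ω = (E.filter fun e => ω ∈ B e).card := by
  simp [eventCount, Set.indicator_apply]

theorem memLp_eventCount [IsFiniteMeasure μ] (hB : ∀ e ∈ E, MeasurableSet (B e)) (p : ENNReal) :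
    MemLp (eventCount E B) p μ :=
  memLp_finsetSum' E fun e he => memLp_indicator_one (hB e he) p

theorem integral_eventCount [IsFiniteMeasure μ] (hB : ∀ e ∈ E, MeasurableSet (B e)) :
    μ[eventCount E B] = ∑ e ∈ E, μ.real (B e) := by
  simp only [eventCount, Finset.sum_apply]
  rw [integral_finsetSum E fun e he => (memLp_indicator_one (hB e he) 1).integrable le_rfl]
  exact Finset.sum_congr rfl fun e he => integral_indicator_one (hB e he)

theorem variance_eventCount_le [IsProbabilityMeasure μ] (hB : ∀ e ∈ E, MeasurableSet (B e))
    (hind : (E : Set κ).Pairwise fun e f => IndepSet (B e) (B f) μ) :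
    Var[eventCount E B; μ] ≤ ∑ e ∈ E, μ.real (B e) := by
  rw [eventCount, IndepFun.variance_sum (fun e he => memLp_indicator_one (hB e he) 2)
    (hind.imp fun _ _ => indepFun_indicator_one_of_indepSet)]
  exact Finset.sum_le_sum fun e he => variance_indicator_one_le (hB e he)

theorem indicator_biInter_compl_le_eventCount (E : Finset κ) (B : κ → Set Ω) (ω : Ω) :
    (⋂ e ∈ E, (B e)ᶜ).indicator (1 : Ω → ℝ) ω ≤
      1 - 3 / 2 * eventCount E B ω + 1 / 2 * eventCount E B ω ^ 2 := by
  classical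
  rw [eventCount_eq_card]
  set N := (E.filter fun e => ω ∈ B e).card with hN
  by_cases hω : ω ∈ ⋂ e ∈ E, (B e)ᶜ
  · have N_eq : N = 0 := by
      rw [hN, Finset.card_eq_zero, Finset.filter_eq_empty_iff]
      simpa using hω
    simp [hω, N_eq]
  · have consecutive : (0 : ℝ) ≤ ((N : ℝ) - 1) * (N - 2) := by
      rcases Nat.lt_or_ge N 2 with h | h
      · interval_cases N <;> norm_num
      · have : (2 : ℝ) ≤ N := by exact_mod_cast h
        nlinarith
    rw [Set.indicator_of_notMem hω]
    linarith

/-- Only pairwise independence enters: `𝟙[N = 0] ≤ (N - 1) (N - 2) / 2` for the number `N` of events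
that occur, and the right-hand side has a second moment in it and nothing higher. -/
theorem measureReal_biInter_compl_le [IsProbabilityMeasure μ] (hB : ∀ e ∈ E, MeasurableSet (B e))
    (hind : (E : Set κ).Pairwise fun e f => IndepSet (B e) (B f) μ) :
    μ.real (⋂ e ∈ E, (B e)ᶜ) ≤
      1 - ∑ e ∈ E, μ.real (B e) + (∑ e ∈ E, μ.real (B e)) ^ 2 / 2 := by
  have meas : MeasurableSet (⋂ e ∈ E, (B e)ᶜ) :=
    E.measurableSet_biInter fun e he => (hB e he).compl
  have int : Integrable (eventCount E B) μ := (memLp_eventCount hB 1).integrable le_rfl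
  have int_sq : Integrable (fun ω => eventCount E B ω ^ 2) μ :=
    (memLp_eventCount hB 2).integrable_sq
  have second_moment : μ[eventCount E B ^ 2] ≤
      ∑ e ∈ E, μ.real (B e) + (∑ e ∈ E, μ.real (B e)) ^ 2 := by
    have := variance_eq_sub (memLp_eventCount (μ := μ) hB 2)
    rw [integral_eventCount hB] at this
    linarith [variance_eventCount_le hB hind]
  calc μ.real (⋂ e ∈ E, (B e)ᶜ) = μ[(⋂ e ∈ E, (B e)ᶜ).indicator 1] :=
        (integral_indicator_one meas).symm
    _ ≤ ∫ ω, (1 - 3 / 2 * eventCount E B ω + 1 / 2 * eventCount E B ω ^ 2) ∂μ :=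
        integral_mono ((memLp_indicator_one meas 1).integrable le_rfl)
          (((integrable_const 1).sub (int.const_mul _)).add (int_sq.const_mul _))
          (indicator_biInter_compl_le_eventCount E B)
    _ = 1 - 3 / 2 * ∑ e ∈ E, μ.real (B e) + 1 / 2 * μ[eventCount E B ^ 2] := by
        rw [integral_add (f := fun ω => 1 - 3 / 2 * eventCount E B ω)
            ((integrable_const 1).sub (int.const_mul _)) (int_sq.const_mul _),
          integral_sub (integrable_const 1) (int.const_mul _), integral_const_mul,
          integral_const_mul, integral_eventCount hB]
        simp
    _ ≤ _ := by linarith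

theorem measureReal_eventCount_lt_half_le [IsProbabilityMeasure μ]
    (hB : ∀ e ∈ E, MeasurableSet (B e))
    (hind : (E : Set κ).Pairwise fun e f => IndepSet (B e) (B f) μ)
    (hpos : 0 < ∑ e ∈ E, μ.real (B e)) :
    μ.real {ω | eventCount E B ω < (∑ e ∈ E, μ.real (B e)) / 2} ≤ 4 / ∑ e ∈ E, μ.real (B e) := by
  set m := ∑ e ∈ E, μ.real (B e) with hm
  have chebyshev : μ.real {ω | m / 2 ≤ |eventCount E B ω - m|} ≤
      Var[eventCount E B; μ] / (m / 2) ^ 2 := by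
    rw [hm, ← integral_eventCount hB]
    refine ENNReal.toReal_le_of_le_ofReal (by positivity [variance_nonneg (eventCount E B) μ]) ?_
    exact meas_ge_le_variance_div_sq (memLp_eventCount hB 2)
      (by rw [integral_eventCount hB]; positivity)
  calc μ.real {ω | eventCount E B ω < m / 2} ≤ μ.real {ω | m / 2 ≤ |eventCount E B ω - m|} := by
        refine measureReal_mono fun ω (hω : eventCount E B ω < m / 2) => ?_
        rw [Set.mem_ofPred_eq, abs_sub_comm]
        exact le_trans (by linarith) (le_abs_self _)
    _ ≤ Var[eventCount E B; μ] / (m / 2) ^ 2 := chebyshev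
    _ ≤ m / (m / 2) ^ 2 := by
        gcongr
        exact variance_eventCount_le hB hind
    _ = 4 / m := by field_simp; norm_num

end EventCount

section PiMeasure

variable {ι κ X : Type*} [Fintype ι] {mX : MeasurableSpace X} {μ : Measure X}

theorem measure_pi_inter_eq_mul [DecidableEq ι] [IsProbabilityMeasure μ] {A B : Set (ι → X)}
    (hA : MeasurableSet A) (hB : MeasurableSet B) {l : ι} {c : ENNReal}
    (hAl : ∀ y z, Function.update y l z ∈ A ↔ y ∈ A)
    (hBl : ∀ y, μ {z | Function.update y l z ∈ B} = c) :
    Measure.pi (fun _ : ι => μ) (A ∩ B) = Measure.pi (fun _ : ι => μ) A * c := by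
  have slice (y : ι → X) : ∫⁻ z, (A ∩ B).indicator 1 (Function.update y l z) ∂μ =
      ∫⁻ z, A.indicator (fun _ => c) (Function.update y l z) ∂μ := by
    have hBy : MeasurableSet {z | Function.update y l z ∈ B} := measurable_update y hB
    by_cases hy : y ∈ A
    · calc ∫⁻ z, (A ∩ B).indicator 1 (Function.update y l z) ∂μ
          = ∫⁻ z, {z | Function.update y l z ∈ B}.indicator 1 z ∂μ :=
            lintegral_congr fun z => by
              rw [Set.inter_indicator_one, Pi.mul_apply, Set.indicator_of_mem ((hAl y z).2 hy),
                Pi.one_apply, one_mul]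
              rfl
        _ = c := by rw [lintegral_indicator_one hBy, hBl]
        _ = ∫⁻ z, A.indicator (fun _ => c) (Function.update y l z) ∂μ := by
            simp [hAl, hy]
    · simp [hAl, hy]
  rw [← lintegral_indicator_one (hA.inter hB), mul_comm, ← lintegral_indicator_const hA c]
  refine lintegral_eq_of_lmarginal_eq {l} (measurable_one.indicator (hA.inter hB))
    (measurable_const.indicator hA) ?_
  simp only [lmarginal_singleton, slice]

theorem measurePreserving_swap_pi [Fintype κ] [IsProbabilityMeasure μ] :
    MeasurePreserving (fun (x : ι → κ → X) (c : κ) (i : ι) => x i c)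
      (Measure.pi fun _ => Measure.pi fun _ => μ) (Measure.pi fun _ => Measure.pi fun _ => μ) := by
  refine ⟨by fun_prop, ?_⟩
  have uncurry := Measure.infinitePi_map_curry_symm (fun (_ : ι) (_ : κ) => μ)
  have curry := Measure.infinitePi_map_curry (fun (_ : κ) (_ : ι) => μ)
  have swap := Measure.map_infinitePi_infinitePi_of_inj (α := κ × ι) (Ω := fun _ : ι × κ => X)
    (P := fun _ => μ) (f := Prod.swap) Prod.swap_injective
  simp only [Measure.infinitePi_eq_pi] at uncurry curry swap
  rw [← curry, ← swap, ← uncurry, Measure.map_map (by fun_prop) (by fun_prop),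
    Measure.map_map (by fun_prop) (by fun_prop)]
  rfl

theorem measureReal_pi_forall_slice_mem [Fintype κ] [IsProbabilityMeasure μ] {A : Set (ι → X)}
    (hA : MeasurableSet A) :
    (Measure.pi fun _ : ι => Measure.pi fun _ : κ => μ).real {x | ∀ c, (fun i => x i c) ∈ A} =
      (Measure.pi fun _ : ι => μ).real A ^ Fintype.card κ := by
  have slices := (measurePreserving_swap_pi (ι := ι) (κ := κ) (μ := μ)).measureReal_preimage
    (s := Set.univ.pi fun _ => A) (MeasurableSet.univ_pi fun _ => hA).nullMeasurableSet
  rw [measureReal_def, measureReal_def, Measure.pi_pi, Finset.prod_const, Finset.card_univ,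
    ENNReal.toReal_pow] at slices
  rw [measureReal_def, measureReal_def, ← slices]
  congr 2
  ext x
  simp

theorem lintegral_prod_pi [IsProbabilityMeasure μ] (s : Finset ι) {f : X → ENNReal}
    (hf : Measurable f) :
    ∫⁻ w, ∏ i ∈ s, f (w i) ∂(Measure.pi fun _ : ι => μ) = (∫⁻ w, f w ∂μ) ^ s.card := by
  have hind : iIndepFun (fun (i : ι) (w : ι → X) => f (w i)) (Measure.pi fun _ : ι => μ) :=
    iIndepFun_pi (X := fun _ => f) fun _ => hf.aemeasurable
  rw [lintegral_prod_eq_prod_lintegral_of_indepFun s _ hind (by fun_prop), ← Finset.prod_const]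
  exact Finset.prod_congr rfl fun i _ =>
    (measurePreserving_eval (fun _ : ι => μ) i).lintegral_comp hf

theorem iIndepFun_eval_pi [IsProbabilityMeasure μ] :
    iIndepFun (fun (i : ι) (w : ι → X) => w i) (Measure.pi fun _ : ι => μ) :=
  iIndepFun_pi (X := fun _ => id) fun _ => aemeasurable_id

end PiMeasure

section OrderedPairs

variable {ι : Type*} [LinearOrder ι] {s : Finset ι}

/-- The unordered pairs of distinct elements of `s`, each represented by its increasing
ordering. -/
def orderedPairs (s : Finset ι) : Finset (ι × ι) :=
  s.offDiag.filter fun e => e.1 < e.2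

theorem mem_orderedPairs {e : ι × ι} :
    e ∈ orderedPairs s ↔ e.1 ∈ s ∧ e.2 ∈ s ∧ e.1 < e.2 := by
  simp only [orderedPairs, Finset.mem_filter, Finset.mem_offDiag]
  exact ⟨fun h => ⟨h.1.1, h.1.2.1, h.2⟩, fun h => ⟨⟨h.1, h.2.1, h.2.2.ne⟩, h.2.2⟩⟩

theorem card_orderedPairs_le : (orderedPairs s).card ≤ s.card ^ 2 :=
  (Finset.card_filter_le _ _).trans (by rw [Finset.offDiag_card, sq]; exact Nat.sub_le _ _)

theorem sum_offDiag_eq_two_mul_sum_orderedPairs {f : ι × ι → ℝ} (hf : ∀ e, f e.swap = f e) :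
    ∑ e ∈ s.offDiag, f e = 2 * ∑ e ∈ orderedPairs s, f e := by
  rw [← Finset.sum_filter_add_sum_filter_not s.offDiag (fun e => e.1 < e.2), two_mul]
  congr 1
  refine Finset.sum_equiv (Equiv.prodComm ι ι) (fun e => ?_) fun e _ => (hf e).symm
  simp only [mem_orderedPairs, Finset.mem_filter, Finset.mem_offDiag, Equiv.prodComm_apply,
    Prod.fst_swap, Prod.snd_swap]
  grind

end OrderedPairs

theorem sum_offDiag_insert_of_swap {ι : Type*} [DecidableEq ι] {s : Finset ι} {f : ι × ι → ℝ}
    (hf : ∀ e, f e.swap = f e) {v : ι} (hv : v ∉ s) :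
    ∑ e ∈ (insert v s).offDiag, f e = ∑ e ∈ s.offDiag, f e + 2 * ∑ i ∈ s, f (v, i) := by
  have row : ∑ e ∈ {v} ×ˢ s, f e = ∑ i ∈ s, f (v, i) := by
    rw [Finset.sum_product, Finset.sum_singleton]
  have column : ∑ e ∈ s ×ˢ {v}, f e = ∑ i ∈ s, f (v, i) := by
    rw [Finset.sum_product]
    exact Finset.sum_congr rfl fun i _ => (Finset.sum_singleton _ _).trans (hf (v, i))
  rw [Finset.offDiag_insert hv, Finset.sum_union, Finset.sum_union, row, column, two_mul, add_assoc]
  all_goals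
    rw [Finset.disjoint_left]
    grind

section IndependentDistances

variable {ι X : Type*} [PseudoMetricSpace X] [SecondCountableTopology X]
  [MeasurableSpace X] [OpensMeasurableSpace X]

theorem measurableSet_lt_dist_pi (t : ℝ) (i j : ι) :
    MeasurableSet {y : ι → X | t < dist (y i) (y j)} :=
  measurableSet_lt measurable_const (by fun_prop)

variable [Fintype ι] {μ : Measure X} [IsProbabilityMeasure μ]

theorem measure_pi_inter_lt_dist [DecidableEq ι] {t : ℝ} {q : ENNReal}
    (hq : ∀ x, μ {z | t < dist x z} = q) {k l : ι} (hkl : k ≠ l) {A : Set (ι → X)}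
    (hA : MeasurableSet A) (hAl : ∀ y z, Function.update y l z ∈ A ↔ y ∈ A) :
    Measure.pi (fun _ : ι => μ) (A ∩ {y | t < dist (y k) (y l)}) =
      Measure.pi (fun _ : ι => μ) A * q :=
  measure_pi_inter_eq_mul hA (measurableSet_lt_dist_pi t k l) hAl fun y => by
    simpa [Function.update_of_ne hkl] using hq (y k)

theorem measure_pi_lt_dist {t : ℝ} {q : ENNReal} (hq : ∀ x, μ {z | t < dist x z} = q)
    {k l : ι} (hkl : k ≠ l) :
    Measure.pi (fun _ : ι => μ) {y | t < dist (y k) (y l)} = q := by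
  classical
  simpa using measure_pi_inter_lt_dist hq hkl MeasurableSet.univ fun _ _ => Iff.rfl

theorem indepSet_lt_dist_of_ne {t u : ℝ} {q : ENNReal} (hq : ∀ x, μ {z | u < dist x z} = q)
    {i j k l : ι} (hkl : k ≠ l) (hil : i ≠ l) (hjl : j ≠ l) :
    IndepSet {y : ι → X | t < dist (y i) (y j)} {y | u < dist (y k) (y l)}
      (Measure.pi fun _ => μ) := by
  classical
  rw [indepSet_iff_measure_inter_eq_mul (measurableSet_lt_dist_pi t i j)
    (measurableSet_lt_dist_pi u k l) (μ := Measure.pi fun _ => μ), measure_pi_lt_dist hq hkl]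
  exact measure_pi_inter_lt_dist hq hkl (measurableSet_lt_dist_pi t i j) fun y z => by
    simp [Function.update_of_ne hil, Function.update_of_ne hjl]

/-- Two distinct pairs have at most one vertex in common, so one of them has an end that the other
does not see. -/
theorem pairwise_indepSet_lt_dist [LinearOrder ι] {t : ι × ι → ℝ} {q : ι × ι → ENNReal}
    (hq : ∀ e x, μ {z | t e < dist x z} = q e) (s : Finset ι) :
    (orderedPairs s : Set (ι × ι)).Pairwise fun e f =>
      IndepSet {y : ι → X | t e < dist (y e.1) (y e.2)} {y | t f < dist (y f.1) (y f.2)}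
        (Measure.pi fun _ => μ) := by
  intro e he f hf hef
  have e_lt := (mem_orderedPairs.1 he).2.2
  have f_lt := (mem_orderedPairs.1 hf).2.2
  by_cases h : e.1 ≠ f.2 ∧ e.2 ≠ f.2
  · exact indepSet_lt_dist_of_ne (hq f) f_lt.ne h.1 h.2
  · have h' : e.1 ≠ f.1 ∧ e.2 ≠ f.1 := by
      grind [Prod.ext_iff]
    simpa only [dist_comm] using indepSet_lt_dist_of_ne (t := t e) (hq f) f_lt.ne' h'.1 h'.2

theorem measureReal_pi_forall_dist_le [LinearOrder ι] {t p : ι × ι → ℝ} (hp : ∀ e, 0 ≤ p e)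
    (hp' : ∀ e x, μ {z | t e < dist x z} = ENNReal.ofReal (p e)) (s : Finset ι) :
    (Measure.pi fun _ : ι => μ).real {y | ∀ e ∈ orderedPairs s, dist (y e.1) (y e.2) ≤ t e} ≤
      1 - ∑ e ∈ orderedPairs s, p e + (∑ e ∈ orderedPairs s, p e) ^ 2 / 2 := by
  have far_prob (e) (he : e ∈ orderedPairs s) :
      (Measure.pi fun _ : ι => μ).real {y | t e < dist (y e.1) (y e.2)} = p e := by
    rw [measureReal_def, measure_pi_lt_dist (hp' e) (mem_orderedPairs.1 he).2.2.ne,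
      ENNReal.toReal_ofReal (hp e)]
  have bonferroni := measureReal_biInter_compl_le
    (fun e _ => measurableSet_lt_dist_pi (X := X) (t e) e.1 e.2) (pairwise_indepSet_lt_dist hp' s)
  rw [Finset.sum_congr rfl far_prob] at bonferroni
  convert bonferroni using 2
  ext y
  simp

end IndependentDistances

section Circle

instance isProbabilityMeasure_volume_unitAddCircle :
    IsProbabilityMeasure (volume : Measure UnitAddCircle) :=
  ⟨by simp⟩

theorem volume_lt_dist_circle {t : ℝ} (ht : 0 ≤ t) (x : UnitAddCircle) :
    volume {z : UnitAddCircle | t < dist x z} = ENNReal.ofReal (1 - min 1 (2 * t)) := by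
  have compl_ball : {z : UnitAddCircle | t < dist x z} = (Metric.closedBall x t)ᶜ := by
    ext z
    simp [dist_comm]
  rw [compl_ball, measure_compl Metric.isClosed_closedBall.measurableSet (measure_ne_top _ _),
    AddCircle.volume_closedBall, ENNReal.ofReal_sub _ (by positivity)]
  simp

theorem measureReal_circle_forall_dist_le {ι : Type*} [Fintype ι] [LinearOrder ι] {t : ι × ι → ℝ}
    (ht : ∀ e, 0 ≤ t e) (s : Finset ι) :
    (volume : Measure (ι → UnitAddCircle)).real
        {y | ∀ e ∈ orderedPairs s, dist (y e.1) (y e.2) ≤ t e} ≤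
      1 - ∑ e ∈ orderedPairs s, (1 - min 1 (2 * t e)) +
        (∑ e ∈ orderedPairs s, (1 - min 1 (2 * t e))) ^ 2 / 2 :=
  measureReal_pi_forall_dist_le (fun _ => sub_nonneg.2 (min_le_left _ _))
    (fun e => volume_lt_dist_circle (ht e)) s

end Circle

section SmallProbabilities

variable {κ : Type*} {E : Finset κ} {τ σ : ℝ}

theorem mul_one_sub_le_one_sub_exp_neg {z : ℝ} (hz : 0 ≤ z) : z * (1 - z) ≤ 1 - Real.exp (-z) := by
  have exp_le : Real.exp (-z) * (1 + z) ≤ 1 := by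
    calc Real.exp (-z) * (1 + z) ≤ Real.exp (-z) * Real.exp z := by
          gcongr
          linarith [Real.add_one_le_exp z]
      _ = 1 := by rw [← Real.exp_add, neg_add_cancel, Real.exp_zero]
  have : z * (1 - z) * (1 + z) ≤ (1 - Real.exp (-z)) * (1 + z) := by
    nlinarith [pow_nonneg hz 3]
  exact le_of_mul_le_mul_right this (by positivity)

theorem one_sub_add_sq_half_le_exp {z : κ → ℝ} (hz : ∀ e ∈ E, 0 ≤ z e) (hzτ : ∀ e ∈ E, z e ≤ τ)
    (hτ : 0 ≤ τ) (hσ₀ : 0 ≤ σ) (hσ : σ ≤ 1 - (1 + E.card / 2) * τ) :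
    1 - ∑ e ∈ E, (1 - Real.exp (-z e)) + (∑ e ∈ E, (1 - Real.exp (-z e))) ^ 2 / 2 ≤
      Real.exp (-(σ * ∑ e ∈ E, z e)) := by
  set S := ∑ e ∈ E, (1 - Real.exp (-z e)) with hS
  set Z := ∑ e ∈ E, z e with hZ
  have Z_nonneg : 0 ≤ Z := Finset.sum_nonneg hz
  have Z_le : Z ≤ E.card * τ := by
    simpa only [nsmul_eq_mul] using Finset.sum_le_card_nsmul E z τ hzτ
  have S_le : S ≤ Z := Finset.sum_le_sum fun e _ => by linarith [Real.one_sub_le_exp_neg (z e)]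
  have S_nonneg : 0 ≤ S := Finset.sum_nonneg fun e he =>
    sub_nonneg.2 (Real.exp_le_one_iff.2 (neg_nonpos.2 (hz e he)))
  have le_S : (1 - τ) * Z ≤ S := by
    rw [hS, hZ, Finset.mul_sum]
    refine Finset.sum_le_sum fun e he => ?_
    nlinarith [mul_one_sub_le_one_sub_exp_neg (hz e he), hz e he, hzτ e he]
  have card_τ : 0 ≤ E.card * τ := by positivity
  calc 1 - S + S ^ 2 / 2 = 1 - S * (1 - S / 2) := by ring
    _ ≤ 1 - (1 - τ) * Z * (1 - E.card * τ / 2) := by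
        gcongr
        · linarith
        · linarith
    _ ≤ 1 - σ * Z := by nlinarith [mul_nonneg card_τ hτ]
    _ ≤ Real.exp (-(σ * Z)) := Real.one_sub_le_exp_neg _

theorem one_sub_add_sq_half_pow_le_prod_rpow {ρ : κ → ℝ} (hρ₀ : ∀ e ∈ E, 0 < ρ e)
    (hρ₁ : ∀ e ∈ E, ρ e ≤ 1) {d : ℕ} (hd : 1 ≤ d) (hτ : 0 ≤ τ)
    (hρτ : ∀ e ∈ E, -Real.log (ρ e) ≤ τ * d) (hσ₀ : 0 ≤ σ) (hσ : σ ≤ 1 - (1 + E.card / 2) * τ) :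
    (1 - ∑ e ∈ E, (1 - ρ e ^ (1 / (d : ℝ))) + (∑ e ∈ E, (1 - ρ e ^ (1 / (d : ℝ)))) ^ 2 / 2) ^ d ≤
      ∏ e ∈ E, ρ e ^ σ := by
  have d_pos : (0 : ℝ) < d := by exact_mod_cast hd
  set z : κ → ℝ := fun e => -Real.log (ρ e) / d with hz
  have ρ_root (e) (he : e ∈ E) : ρ e ^ (1 / (d : ℝ)) = Real.exp (-z e) := by
    rw [Real.rpow_def_of_pos (hρ₀ e he)]
    congr 1
    ring
  have ρ_rpow (e) (he : e ∈ E) : ρ e ^ σ = Real.exp (-(d * σ * z e)) := by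
    rw [Real.rpow_def_of_pos (hρ₀ e he)]
    congr 1
    simp only [hz]
    field_simp
  rw [Finset.sum_congr rfl fun e he => by rw [ρ_root e he], Finset.prod_congr rfl ρ_rpow,
    ← Real.exp_sum, Finset.sum_neg_distrib, ← Finset.mul_sum, mul_assoc, ← mul_neg,
    Real.exp_nat_mul]
  refine pow_le_pow_left₀ ?_
    (one_sub_add_sq_half_le_exp (fun e he => ?_) (fun e he => ?_) hτ hσ₀ hσ) d
  · nlinarith [sq_nonneg (∑ e ∈ E, (1 - Real.exp (-z e)) - 1)]
  · exact div_nonneg (neg_nonneg.2 (Real.log_nonpos (hρ₀ e he).le (hρ₁ e he))) d_pos.le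
  · exact (div_le_iff₀ d_pos).2 (hρτ e he)

theorem min_one_rpow {x p : ℝ} (hx : 0 ≤ x) (hp : 0 ≤ p) : min 1 (x ^ p) = min 1 x ^ p := by
  rcases le_total 1 x with h | h
  · rw [min_eq_left h, min_eq_left (Real.one_le_rpow h hp), Real.one_rpow]
  · rw [min_eq_right h, min_eq_right (Real.rpow_le_one hx h hp)]

theorem neg_log_min_one_le {x c : ℝ} (hc : 0 ≤ c) (hx : -Real.log x ≤ c) :
    -Real.log (min 1 x) ≤ c := by
  rcases min_choice 1 x with h | h <;> simp [h, hc, hx]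

end SmallProbabilities

theorem measureReal_torus_forall_dist_le {ι : Type*} [Fintype ι] [LinearOrder ι] {s : Finset ι}
    {d : ℕ} (hd : 1 ≤ d) {ρ : ι × ι → ℝ} (hρ : ∀ e, 0 < ρ e) {τ σ : ℝ} (hτ : 0 ≤ τ)
    (hρτ : ∀ e, -Real.log (ρ e) ≤ τ * d) (hσ₀ : 0 ≤ σ)
    (hσ : σ ≤ 1 - (1 + (orderedPairs s).card / 2) * τ) :
    (volume : Measure (ι → Fin d → UnitAddCircle)).real
        {x | ∀ e ∈ orderedPairs s, dist (x e.1) (x e.2) ≤ 1 / 2 * ρ e ^ (1 / (d : ℝ))} ≤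
      ∏ e ∈ orderedPairs s, min 1 (ρ e) ^ σ := by
  set t : ι × ι → ℝ := fun e => 1 / 2 * ρ e ^ (1 / (d : ℝ)) with ht
  have t_nonneg (e) : 0 ≤ t e := by
    have := hρ e
    positivity
  set A : Set (ι → UnitAddCircle) := {y | ∀ e ∈ orderedPairs s, dist (y e.1) (y e.2) ≤ t e} with hA
  have measurableSet_A : MeasurableSet A := by
    simp only [hA, Set.ofPred_forall]
    exact (orderedPairs s).measurableSet_biInter fun e _ =>
      measurableSet_le (by fun_prop) measurable_const
  have coordinatewise : {x : ι → Fin d → UnitAddCircle |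
      ∀ e ∈ orderedPairs s, dist (x e.1) (x e.2) ≤ t e} = {x | ∀ c, (fun i => x i c) ∈ A} := by
    ext x
    simp only [hA, Set.mem_ofPred_eq, dist_pi_le_iff (t_nonneg _)]
    exact ⟨fun h c e he => h e he c, fun h e he c => h c e he⟩
  have one_coordinate := measureReal_circle_forall_dist_le t_nonneg s
  have min_two_mul_t (e) : min 1 (2 * t e) = min 1 (ρ e) ^ (1 / (d : ℝ)) := by
    rw [← min_one_rpow (hρ e).le (by positivity), ht]
    ring_nf
  simp only [min_two_mul_t] at one_coordinate
  calc (volume : Measure (ι → Fin d → UnitAddCircle)).real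
        {x | ∀ e ∈ orderedPairs s, dist (x e.1) (x e.2) ≤ t e}
      = (volume : Measure (ι → UnitAddCircle)).real A ^ d := by
        rw [coordinatewise]
        exact (measureReal_pi_forall_slice_mem measurableSet_A).trans
          (by rw [Fintype.card_fin, volume_pi])
    _ ≤ _ := pow_le_pow_left₀ measureReal_nonneg one_coordinate d
    _ ≤ ∏ e ∈ orderedPairs s, min 1 (ρ e) ^ σ :=
        one_sub_add_sq_half_pow_le_prod_rpow (fun e _ => lt_min one_pos (hρ e))
          (fun e _ => min_le_left _ _) hd hτ
          (fun e _ => neg_log_min_one_le (by positivity) (hρτ e)) hσ₀ hσ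

section Exponents

variable {a b : ℝ}

theorem mul_min_zero_le {σ c t : ℝ} (hc₀ : 0 ≤ c) (hc : c ≤ σ) : σ * min 0 t ≤ c * t := by
  rcases le_total 0 t with h | h
  · rw [min_eq_left h, mul_zero]
    positivity
  · rw [min_eq_right h]
    exact mul_le_mul_of_nonpos_right hc h

theorem min_mul_eq_of_nonneg {x : ℝ} (hba : b ≤ a) (hx : 0 ≤ x) : min (a * x) (b * x) = b * x :=
  min_eq_right (mul_le_mul_of_nonneg_right hba hx)

theorem min_mul_eq_of_nonpos {x : ℝ} (hba : b ≤ a) (hx : x ≤ 0) : min (a * x) (b * x) = a * x :=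
  min_eq_left (mul_le_mul_of_nonpos_right hba hx)

theorem triangle_exponent_le_of_le (hba : b ≤ a) (hab : a ≤ 2 * b) {x y z : ℝ} (hyx : y ≤ x)
    (hzy : z ≤ y) :
    (a - b / 2) * min 0 (x + y) + (a - b / 2) * min 0 (x + z) + (a - b / 2) * min 0 (y + z) ≤
      min (a * x) (b * x) + min (a * y) (b * y) + min (a * z) (b * z) := by
  have pair_le {c : ℝ} (hc₀ : 0 ≤ c) (hc : c ≤ a - b / 2) (t : ℝ) :
      (a - b / 2) * min 0 t ≤ c * t := mul_min_zero_le hc₀ hc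
  have half_a := pair_le (c := a / 2) (by linarith) (by linarith)
  have half_b := pair_le (c := b / 2) (by linarith) (by linarith)
  have full := pair_le (c := a - b / 2) (by linarith) le_rfl
  have zero (t : ℝ) : (a - b / 2) * min 0 t ≤ 0 := by
    simpa using pair_le (c := 0) le_rfl (by linarith) t
  rcases le_total x 0 with hx | hx
  · rw [min_mul_eq_of_nonpos hba hx, min_mul_eq_of_nonpos hba (hyx.trans hx),
      min_mul_eq_of_nonpos hba ((hzy.trans hyx).trans hx)]
    linarith [half_a (x + y), half_a (x + z), half_a (y + z)]
  rw [min_mul_eq_of_nonneg hba hx]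
  rcases le_total y 0 with hy | hy
  · rw [min_mul_eq_of_nonpos hba hy, min_mul_eq_of_nonpos hba (hzy.trans hy)]
    linarith [half_b (x + y), half_b (x + z), full (y + z)]
  rw [min_mul_eq_of_nonneg hba hy]
  have b_nonneg : 0 ≤ b := by linarith
  rcases le_total z 0 with hz | hz
  · rw [min_mul_eq_of_nonpos hba hz]
    have : a / 2 * (x + y) ≤ b * (x + y) :=
      mul_le_mul_of_nonneg_right (by linarith) (by linarith)
    linarith [zero (x + y), half_a (x + z), half_a (y + z)]
  · rw [min_mul_eq_of_nonneg hba hz]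
    have : 0 ≤ b * x + b * y + b * z := by positivity
    linarith [zero (x + y), zero (x + z), zero (y + z)]

theorem triangle_exponent_le (hba : b ≤ a) (hab : a ≤ 2 * b) {x y z : ℝ} (hyx : y ≤ x)
    (hzx : z ≤ x) :
    (a - b / 2) * min 0 (x + y) + (a - b / 2) * min 0 (x + z) + (a - b / 2) * min 0 (y + z) ≤
      min (a * x) (b * x) + min (a * y) (b * y) + min (a * z) (b * z) := by
  rcases le_total z y with hzy | hyz
  · exact triangle_exponent_le_of_le hba hab hyx hzy
  · have := triangle_exponent_le_of_le hba hab hzx hyz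
    rw [add_comm z y] at this
    linarith

theorem sum_max_exponent_le {ι : Type*} (hba : b ≤ a) (hab : a ≤ 2 * b) {x : ι → ℝ} {v : ι}
    {s : Finset ι} (hmax : ∀ i ∈ s, x i ≤ x v) (hs : 2 ≤ s.card) :
    ∑ i ∈ s, (a - b / 2) * min 0 (x v + x i) ≤ min (a * x v) (b * x v) := by
  have σ_nonneg : 0 ≤ a - b / 2 := by linarith
  rcases le_total 0 (x v) with hx | hx
  · rw [min_mul_eq_of_nonneg hba hx]
    refine (Finset.sum_nonpos fun i _ => ?_).trans (mul_nonneg (by linarith) hx)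
    exact mul_nonpos_of_nonneg_of_nonpos σ_nonneg (min_le_left _ _)
  · rw [min_mul_eq_of_nonpos hba hx]
    have card_ge : (2 : ℝ) ≤ s.card := by exact_mod_cast hs
    calc ∑ i ∈ s, (a - b / 2) * min 0 (x v + x i) ≤ ∑ i ∈ s, a / 2 * (2 * x v) := by
          refine Finset.sum_le_sum fun i hi => ?_
          refine (mul_min_zero_le (c := a / 2) (by linarith) (by linarith)).trans ?_
          exact mul_le_mul_of_nonneg_left (by linarith [hmax i hi]) (by linarith)
      _ = s.card * (a * x v) := by
          rw [Finset.sum_const, nsmul_eq_mul]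
          ring
      _ ≤ a * x v := by
          nlinarith [mul_nonpos_of_nonneg_of_nonpos (by linarith : 0 ≤ a) hx]

theorem sum_offDiag_exponent_le {ι : Type*} (hba : b ≤ a) (hab : a ≤ 2 * b) (x : ι → ℝ)
    {s : Finset ι} (hs : 3 ≤ s.card) :
    ∑ e ∈ s.offDiag, (a - b / 2) * min 0 (x e.1 + x e.2) ≤
      2 * ∑ i ∈ s, min (a * x i) (b * x i) := by
  classical
  have insert_max {v : ι} {s : Finset ι} (hv : v ∉ s) :=
    sum_offDiag_insert_of_swap (f := fun e => (a - b / 2) * min 0 (x e.1 + x e.2))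
      (fun e => by rw [Prod.fst_swap, Prod.snd_swap, add_comm]) hv
  induction s using Finset.induction_on_max_value x with
  | empty => simp at hs
  | insert v s hv hmax ih =>
    rw [insert_max hv, Finset.sum_insert hv]
    rw [Finset.card_insert_of_notMem hv] at hs
    rcases (show s.card = 2 ∨ 3 ≤ s.card by omega) with card_eq | card_ge
    · obtain ⟨y, z, hyz, rfl⟩ := Finset.card_eq_two.1 card_eq
      rw [insert_max (Finset.notMem_singleton.2 hyz), Finset.sum_pair hyz, Finset.sum_pair hyz,
        Finset.offDiag_singleton, Finset.sum_empty, Finset.sum_singleton]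
      linarith [triangle_exponent_le hba hab (hmax y (by simp)) (hmax z (by simp))]
    · linarith [ih card_ge, sum_max_exponent_le hba hab hmax (by omega : 2 ≤ s.card)]

theorem prod_min_one_rpow_le {ι : Type*} [LinearOrder ι] (hba : b ≤ a) (hab : a ≤ 2 * b)
    {u : ι → ℝ} (hu : ∀ i, 0 < u i) {s : Finset ι} (hs : 3 ≤ s.card) :
    ∏ e ∈ orderedPairs s, min 1 (u e.1 * u e.2) ^ (a - b / 2) ≤
      ∏ i ∈ s, min (u i ^ a) (u i ^ b) := by
  have pair (e : ι × ι) : min 1 (u e.1 * u e.2) ^ (a - b / 2) =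
      Real.exp ((a - b / 2) * min 0 (Real.log (u e.1) + Real.log (u e.2))) := by
    have hpos := mul_pos (hu e.1) (hu e.2)
    rw [Real.rpow_def_of_pos (lt_min one_pos hpos), mul_comm, ← Real.log_mul (hu _).ne' (hu _).ne',
      Real.strictMonoOn_log.monotoneOn.map_min (Set.mem_Ioi.2 one_pos) hpos, Real.log_one]
  have single (i : ι) : min (u i ^ a) (u i ^ b) =
      Real.exp (min (a * Real.log (u i)) (b * Real.log (u i))) := by
    rw [Real.exp_monotone.map_min, Real.rpow_def_of_pos (hu i), Real.rpow_def_of_pos (hu i),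
      mul_comm a, mul_comm b]
  have offDiag_le := sum_offDiag_exponent_le hba hab (fun i => Real.log (u i)) hs
  rw [sum_offDiag_eq_two_mul_sum_orderedPairs fun e => by
    rw [Prod.fst_swap, Prod.snd_swap, add_comm]] at offDiag_le
  simp only [pair, single, ← Real.exp_sum]
  exact Real.exp_le_exp.2 (le_of_mul_le_mul_left offDiag_le two_pos)

end Exponents

section Pareto

theorem lintegral_Ioc_rpow {η r : ℝ} (hη : 0 < η) (hr : 0 ≤ r) :
    ∫⁻ w in Set.Ioc 0 r, ENNReal.ofReal (w ^ (η - 1)) = ENNReal.ofReal (r ^ η / η) := by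
  have integrable : IntegrableOn (fun w : ℝ => w ^ (η - 1)) (Set.Ioc 0 r) :=
    (intervalIntegrable_iff_integrableOn_Ioc_of_le hr).1
      (intervalIntegral.intervalIntegrable_rpow' (by linarith))
  rw [← ofReal_integral_eq_lintegral_ofReal integrable, ← intervalIntegral.integral_of_le hr,
    integral_rpow (Or.inl (by linarith)), sub_add_cancel, Real.zero_rpow hη.ne', sub_zero]
  filter_upwards [ae_restrict_mem measurableSet_Ioc] with w hw using Real.rpow_nonneg hw.1.le _

theorem lintegral_Ioi_rpow {η r : ℝ} (hη : 0 < η) (hr : 0 < r) :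
    ∫⁻ w in Set.Ioi r, ENNReal.ofReal (w ^ (-η - 1)) = ENNReal.ofReal (r ^ (-η) / η) := by
  rw [← ofReal_integral_eq_lintegral_ofReal (integrableOn_Ioi_rpow_of_lt (by linarith) hr),
    integral_Ioi_rpow_of_lt (by linarith) hr, sub_add_cancel, neg_div_neg_eq]
  filter_upwards [ae_restrict_mem measurableSet_Ioi] with w hw
    using Real.rpow_nonneg (hr.trans hw).le _

variable {t γ r : ℝ}

theorem measurable_paretoPDF : Measurable (paretoPDF t γ) :=
  (measurable_paretoPDFReal t γ).ennreal_ofReal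

theorem ae_le_paretoMeasure : ∀ᵐ w ∂(paretoMeasure t γ), t ≤ w := by
  rw [paretoMeasure, ae_withDensity_iff measurable_paretoPDF]
  exact ae_of_all _ fun w hw => not_lt.1 fun hwt => hw (paretoPDF_of_lt hwt)

theorem paretoMeasure_Ici (ht : 0 < t) (hγ : 0 < γ) (hr : t ≤ r) :
    paretoMeasure t γ (Set.Ici r) = ENNReal.ofReal (t ^ γ * r ^ (-γ)) := by
  have density (w : ℝ) (hw : w ∈ Set.Ici r) :
      paretoPDF t γ w = ENNReal.ofReal (γ * t ^ γ) * ENNReal.ofReal (w ^ (-γ - 1)) := by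
    rw [paretoPDF_of_le (hr.trans hw), ENNReal.ofReal_mul (by positivity), neg_add']
  rw [paretoMeasure, withDensity_apply _ measurableSet_Ici,
    setLIntegral_congr_fun measurableSet_Ici density, lintegral_const_mul _ (by fun_prop),
    setLIntegral_congr Ioi_ae_eq_Ici.symm, lintegral_Ioi_rpow hγ (ht.trans_le hr),
    ← ENNReal.ofReal_mul (by positivity)]
  congr 1
  field_simp

theorem setLIntegral_div_rpow_paretoMeasure_le (ht : 0 < t) (hγ : 0 < γ) (hr : 0 ≤ r) {s : Set ℝ}
    (hs : MeasurableSet s) (c : ℝ) :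
    ∫⁻ w in s, ENNReal.ofReal ((w / r) ^ c) ∂(paretoMeasure t γ) ≤
      ENNReal.ofReal (γ * t ^ γ * r ^ (-c)) * ∫⁻ w in s, ENNReal.ofReal (w ^ (c - γ - 1)) := by
  rw [paretoMeasure, setLIntegral_withDensity_eq_setLIntegral_mul _ measurable_paretoPDF
    (by fun_prop) hs, ← lintegral_const_mul _ (by fun_prop)]
  refine lintegral_mono fun w => ?_
  rw [Pi.mul_apply]
  rcases lt_or_ge w t with hwt | htw
  · rw [paretoPDF_of_lt hwt, zero_mul]
    exact zero_le
  · have w_pos : 0 < w := ht.trans_le htw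
    rw [paretoPDF_of_le htw, ← ENNReal.ofReal_mul (by positivity),
      ← ENNReal.ofReal_mul (by positivity), Real.div_rpow w_pos.le hr, Real.rpow_neg hr,
      show c - γ - 1 = -(γ + 1) + c by ring, Real.rpow_add w_pos]
    apply le_of_eq
    ring_nf

theorem lintegral_min_rpow_paretoMeasure_le {η : ℝ} (ht : 0 < t) (hγ : 0 < γ) (hη : 0 < η)
    (hr : 0 < r) :
    ∫⁻ w, ENNReal.ofReal (min ((w / r) ^ (γ + η)) ((w / r) ^ (γ - η))) ∂(paretoMeasure t γ) ≤
      ENNReal.ofReal (γ * t ^ γ * (2 / η) * r ^ (-γ)) := by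
  have ae_pos : ∀ᵐ w ∂(paretoMeasure t γ), w ∈ Set.Ioi 0 :=
    ae_le_paretoMeasure.mono fun w htw => ht.trans_le htw
  have below := setLIntegral_div_rpow_paretoMeasure_le ht hγ hr.le
    (measurableSet_Ioc (a := 0) (b := r)) (γ + η)
  have above := setLIntegral_div_rpow_paretoMeasure_le ht hγ hr.le
    (measurableSet_Ioi (a := r)) (γ - η)
  rw [show γ + η - γ - 1 = η - 1 by ring, lintegral_Ioc_rpow hη hr.le,
    ← ENNReal.ofReal_mul (by positivity)] at below
  rw [show γ - η - γ - 1 = -η - 1 by ring, lintegral_Ioi_rpow hη hr,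
    ← ENNReal.ofReal_mul (by positivity)] at above
  rw [← Measure.restrict_eq_self_of_ae_mem ae_pos, ← Set.Ioc_union_Ioi_eq_Ioi hr.le]
  refine (lintegral_union_le _ _ _).trans ((add_le_add
    ((lintegral_mono fun w => ENNReal.ofReal_le_ofReal (min_le_left _ _)).trans below)
    ((lintegral_mono fun w => ENNReal.ofReal_le_ofReal (min_le_right _ _)).trans above)).trans ?_)
  have cancel_add : r ^ (-(γ + η)) * r ^ η = r ^ (-γ) := by
    rw [← Real.rpow_add hr]
    ring_nf
  have cancel_sub : r ^ (-(γ - η)) * r ^ (-η) = r ^ (-γ) := by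
    rw [← Real.rpow_add hr]
    ring_nf
  rw [← ENNReal.ofReal_add (by positivity) (by positivity)]
  refine ENNReal.ofReal_le_ofReal (le_of_eq ?_)
  calc _ = γ * t ^ γ / η * (r ^ (-(γ + η)) * r ^ η + r ^ (-(γ - η)) * r ^ (-η)) := by ring
    _ = γ * t ^ γ * (2 / η) * r ^ (-γ) := by
      rw [cancel_add, cancel_sub]
      ring

end Pareto

section CliqueEvent

variable {β w₀ lam : ℝ} {n d : ℕ} {s t : Finset (Fin n)}

theorem isProbabilityMeasure_girgVertexLaw (hβ : 1 < β) (hw₀ : 0 < w₀) (d : ℕ) :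
    IsProbabilityMeasure (girgVertexLaw β w₀ d) := by
  have := isProbabilityMeasure_paretoMeasure hw₀ (sub_pos.2 hβ)
  unfold girgVertexLaw
  infer_instance

theorem isProbabilityMeasure_girgLaw (hβ : 1 < β) (hw₀ : 0 < w₀) (n d : ℕ) :
    IsProbabilityMeasure (girgLaw n β w₀ d) := by
  have := isProbabilityMeasure_girgVertexLaw hβ hw₀ d
  unfold girgLaw
  infer_instance

/-- The event that the vertices in `s` are pairwise adjacent. -/
def cliqueEvent (lam : ℝ) (d : ℕ) (s : Finset (Fin n)) : Set (Fin n → GIRGVertex d) :=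
  {ω | (girgGraph lam ω).IsClique s}

/-- The set of attributes of the vertices in `s` for which these vertices are pairwise adjacent:
the event `cliqueEvent lam d s` as a subset of the coordinates in `s`. -/
def cliqueAttributes (lam : ℝ) (d : ℕ) (s : Finset (Fin n)) : Set (s → GIRGVertex d) :=
  {a | ∀ i j, i < j → dist (a i).2 (a j).2 ≤ connectionThreshold lam n d (a i).1 (a j).1}

theorem mem_cliqueEvent {ω : Fin n → GIRGVertex d} :
    ω ∈ cliqueEvent lam d s ↔ ∀ e ∈ orderedPairs s,
      dist (ω e.1).2 (ω e.2).2 ≤ connectionThreshold lam n d (ω e.1).1 (ω e.2).1 := by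
  constructor
  · intro clique e he
    obtain ⟨he₁, he₂, hlt⟩ := mem_orderedPairs.1 he
    exact (clique he₁ he₂ hlt.ne).2
  · intro close i hi j hj hij
    rcases hij.lt_or_gt with hlt | hlt
    · exact ⟨hij, close (i, j) (mem_orderedPairs.2 ⟨hi, hj, hlt⟩)⟩
    · exact SimpleGraph.Adj.symm ⟨hij.symm, close (j, i) (mem_orderedPairs.2 ⟨hj, hi, hlt⟩)⟩

theorem cliqueEvent_subset (hst : s ⊆ t) : cliqueEvent lam d t ⊆ cliqueEvent lam d s :=
  fun _ clique => SimpleGraph.IsClique.subset (Finset.coe_subset.2 hst) clique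

theorem cliqueEvent_eq_preimage :
    cliqueEvent lam d s = (fun ω (i : s) => ω i) ⁻¹' cliqueAttributes lam d s := by
  ext ω
  simp only [mem_cliqueEvent, cliqueAttributes, Set.mem_preimage, Set.mem_ofPred_eq]
  exact ⟨fun h i j hij => h (i, j) (mem_orderedPairs.2 ⟨i.2, j.2, hij⟩), fun h e he =>
    h ⟨e.1, (mem_orderedPairs.1 he).1⟩ ⟨e.2, (mem_orderedPairs.1 he).2.1⟩
      (mem_orderedPairs.1 he).2.2⟩

theorem measurableSet_cliqueAttributes : MeasurableSet (cliqueAttributes lam d s) := by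
  simp only [cliqueAttributes, connectionThreshold, Set.ofPred_forall]
  exact MeasurableSet.iInter fun i => MeasurableSet.iInter fun j => MeasurableSet.iInter fun _ =>
    measurableSet_le (by fun_prop) (by fun_prop)

theorem measurableSet_cliqueEvent : MeasurableSet (cliqueEvent lam d s) := by
  rw [cliqueEvent_eq_preimage]
  exact measurableSet_cliqueAttributes.preimage (by fun_prop)

theorem measure_cliqueEvent_union_le (hβ : 1 < β) (hw₀ : 0 < w₀) (hst : Disjoint s t) :
    girgLaw n β w₀ d (cliqueEvent lam d (s ∪ t)) ≤
      girgLaw n β w₀ d (cliqueEvent lam d s) * girgLaw n β w₀ d (cliqueEvent lam d t) := by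
  have := isProbabilityMeasure_girgVertexLaw hβ hw₀ d
  have indep : IndepFun (fun ω (i : s) => ω i) (fun ω (i : t) => ω i) (girgLaw n β w₀ d) :=
    iIndepFun_eval_pi.indepFun_finset s t hst fun i => measurable_pi_apply i
  have inter_eq_mul := indep.measure_inter_preimage_eq_mul _ _
    (measurableSet_cliqueAttributes (lam := lam)) (measurableSet_cliqueAttributes (lam := lam))
  rw [← cliqueEvent_eq_preimage, ← cliqueEvent_eq_preimage] at inter_eq_mul
  rw [← inter_eq_mul]
  exact measure_mono (Set.subset_inter (cliqueEvent_subset Finset.subset_union_left)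
    (cliqueEvent_subset Finset.subset_union_right))

theorem measure_cliqueEvent_eq_lintegral (hβ : 1 < β) (hw₀ : 0 < w₀) :
    girgLaw n β w₀ d (cliqueEvent lam d s) =
      ∫⁻ w, (volume : Measure (Fin n → Fin d → UnitAddCircle))
        {x | ∀ e ∈ orderedPairs s, dist (x e.1) (x e.2) ≤
          connectionThreshold lam n d (w e.1) (w e.2)}
        ∂(Measure.pi fun _ => paretoMeasure w₀ (β - 1)) := by
  have := isProbabilityMeasure_paretoMeasure hw₀ (sub_pos.2 hβ)
  have split := (measurePreserving_arrowProdEquivProdArrow ℝ (Fin d → UnitAddCircle) (Fin n)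
    (fun _ => paretoMeasure w₀ (β - 1)) (fun _ => volume)).symm
  simp only [girgLaw, girgVertexLaw]
  rw [← split.measure_preimage measurableSet_cliqueEvent.nullMeasurableSet,
    Measure.prod_apply (measurableSet_cliqueEvent.preimage split.measurable)]
  refine lintegral_congr fun w => ?_
  congr 1
  ext x
  exact mem_cliqueEvent

theorem ae_forall_le_weight (hβ : 1 < β) (hw₀ : 0 < w₀) :
    ∀ᵐ w ∂(Measure.pi fun _ : Fin n => paretoMeasure w₀ (β - 1)), ∀ i, w₀ ≤ w i := by
  have := isProbabilityMeasure_paretoMeasure hw₀ (sub_pos.2 hβ)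
  exact ae_all_iff.2 fun i =>
    (Measure.quasiMeasurePreserving_eval (fun _ => paretoMeasure w₀ (β - 1)) i).ae
      ae_le_paretoMeasure

theorem measureReal_forall_dist_le_prod {τ a b : ℝ} (hlam : 0 < lam) (hw₀ : 0 < w₀) (hn : 0 < n)
    (hd : 1 ≤ d) (hτ : 0 ≤ τ) (hlog : -Real.log (lam * (w₀ * w₀) / n) ≤ τ * d)
    (hba : b ≤ a) (hab : a ≤ 2 * b)
    (hσ : a - b / 2 ≤ 1 - (1 + (orderedPairs s).card / 2) * τ) (hs : 3 ≤ s.card) {w : Fin n → ℝ}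
    (hw : ∀ i, w₀ ≤ w i) :
    (volume : Measure (Fin n → Fin d → UnitAddCircle)).real
        {x | ∀ e ∈ orderedPairs s, dist (x e.1) (x e.2) ≤
          connectionThreshold lam n d (w e.1) (w e.2)} ≤
      ∏ i ∈ s, min ((w i / √(n / lam)) ^ a) ((w i / √(n / lam)) ^ b) := by
  have : (0 : ℝ) < n := by exact_mod_cast hn
  have w_pos (i) : 0 < w i := hw₀.trans_le (hw i)
  have root_pos : 0 < √(n / lam) := Real.sqrt_pos.2 (by positivity)
  have normalize (e : Fin n × Fin n) :
      lam * (w e.1 * w e.2) / n = w e.1 / √(n / lam) * (w e.2 / √(n / lam)) := by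
    rw [div_mul_div_comm, Real.mul_self_sqrt (by positivity), div_div_eq_mul_div, mul_comm lam]
  have log_le (e : Fin n × Fin n) : -Real.log (lam * (w e.1 * w e.2) / n) ≤ τ * d := by
    refine (neg_le_neg (Real.log_le_log (by positivity) ?_)).trans hlog
    gcongr
    exacts [(w_pos _).le, hw _, hw _]
  have clique_le := measureReal_torus_forall_dist_le (s := s)
    (ρ := fun e => lam * (w e.1 * w e.2) / n) hd (fun e => by
      have := w_pos e.1
      have := w_pos e.2
      positivity) hτ log_le (by linarith : 0 ≤ a - b / 2) hσ
  simp only [connectionThreshold, mul_assoc]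
  refine clique_le.trans ?_
  simp only [normalize]
  exact prod_min_one_rpow_le hba hab (fun i => div_pos (w_pos i) root_pos) hs

theorem measure_cliqueEvent_le_lintegral_min_pow {τ a b : ℝ} (hβ : 1 < β) (hlam : 0 < lam)
    (hw₀ : 0 < w₀) (hn : 0 < n) (hd : 1 ≤ d) (hτ : 0 ≤ τ)
    (hlog : -Real.log (lam * (w₀ * w₀) / n) ≤ τ * d) (hba : b ≤ a) (hab : a ≤ 2 * b)
    (hσ : a - b / 2 ≤ 1 - (1 + (orderedPairs s).card / 2) * τ) (hs : 3 ≤ s.card) :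
    girgLaw n β w₀ d (cliqueEvent lam d s) ≤
      (∫⁻ w, ENNReal.ofReal (min ((w / √(n / lam)) ^ a) ((w / √(n / lam)) ^ b))
        ∂(paretoMeasure w₀ (β - 1))) ^ s.card := by
  have := isProbabilityMeasure_paretoMeasure hw₀ (sub_pos.2 hβ)
  rw [measure_cliqueEvent_eq_lintegral hβ hw₀, ← lintegral_prod_pi s (by fun_prop)]
  refine lintegral_mono_ae ?_
  filter_upwards [ae_forall_le_weight hβ hw₀] with w hw
  have ratio_nonneg (i) : 0 ≤ w i / √(n / lam) :=
    div_nonneg (hw₀.trans_le (hw i)).le (Real.sqrt_nonneg _)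
  rw [← ENNReal.ofReal_prod_of_nonneg fun i _ =>
      le_min (Real.rpow_nonneg (ratio_nonneg i) _) (Real.rpow_nonneg (ratio_nonneg i) _),
    ← ofReal_measureReal]
  exact ENNReal.ofReal_le_ofReal
    (measureReal_forall_dist_le_prod hlam hw₀ hn hd hτ hlog hba hab hσ hs hw)

/-- Splitting off triples bounds the number of pairs that have to be handled at once, and hence the
error in the second-order expansion, by a constant. -/
theorem measure_cliqueEvent_le_pow (hβ : 1 < β) (hw₀ : 0 < w₀) {q : ENNReal}
    (hq : ∀ s : Finset (Fin n), 3 ≤ s.card → s.card ≤ 5 →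
      girgLaw n β w₀ d (cliqueEvent lam d s) ≤ q ^ s.card) (hs : 3 ≤ s.card) :
    girgLaw n β w₀ d (cliqueEvent lam d s) ≤ q ^ s.card := by
  induction s using Finset.strongInduction with
  | H s ih =>
    by_cases small : s.card ≤ 5
    · exact hq s hs small
    obtain ⟨t, hts, card_t⟩ := Finset.exists_subset_card_eq hs
    have card_sdiff : (s \ t).card = s.card - 3 := by rw [Finset.card_sdiff_of_subset hts, card_t]
    have sdiff_le := ih (s \ t) (Finset.sdiff_ssubset hts (Finset.card_pos.1 (by omega))) (by omega)
    have union_le := measure_cliqueEvent_union_le hβ hw₀ (lam := lam) (d := d)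
      (Finset.disjoint_sdiff (s := t) (t := s))
    rw [Finset.union_sdiff_of_subset hts] at union_le
    calc girgLaw n β w₀ d (cliqueEvent lam d s) ≤ q ^ t.card * q ^ (s \ t).card :=
          union_le.trans (mul_le_mul' (hq t card_t.ge (by omega)) sdiff_le)
      _ = q ^ s.card := by rw [← pow_add, add_comm, Finset.card_sdiff_add_card_eq_card hts]

theorem sqrt_div_rpow_neg {x : ℝ} (hx : 0 ≤ x) (hlam : 0 ≤ lam) :
    √(x / lam) ^ (-(β - 1)) = lam ^ ((β - 1) / 2) * x ^ ((1 - β) / 2) := by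
  rw [Real.sqrt_eq_rpow, ← Real.rpow_mul (div_nonneg hx hlam), Real.div_rpow hx hlam,
    div_eq_mul_inv, ← Real.rpow_neg hlam, mul_comm]
  ring_nf

theorem eventually_one_le_and_neg_log_div_le {c τ : ℝ} (hc : 0 < c) (hτ : 0 < τ) :
    ∀ᶠ n : ℕ in atTop, ∀ d : ℕ, 2 / τ * Real.log n ≤ d → 1 ≤ d ∧ -Real.log (c / n) ≤ τ * d := by
  have log_tendsto := Real.tendsto_log_atTop.comp tendsto_natCast_atTop_atTop
  filter_upwards [log_tendsto.eventually_gt_atTop 0, log_tendsto.eventually_ge_atTop (-Real.log c),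
    eventually_gt_atTop 0] with n log_pos log_ge n_pos d hd
  rw [Function.comp_apply] at log_pos log_ge
  have d_pos : (0 : ℝ) < d := lt_of_lt_of_le (by positivity) hd
  rw [div_mul_eq_mul_div, div_le_iff₀ hτ] at hd
  refine ⟨by exact_mod_cast d_pos, ?_⟩
  rw [Real.log_div hc.ne' (by exact_mod_cast n_pos.ne')]
  linarith

theorem exists_measureReal_cliqueEvent_le (hβ : 1 < β) (hβ' : β < 3) (hw₀ : 0 < w₀)
    (hlam : 0 < lam) :
    ∃ D C : ℝ, 0 < C ∧ ∀ᶠ n : ℕ in atTop, ∀ d : ℕ, D * Real.log n ≤ d →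
      ∀ s : Finset (Fin n), 3 ≤ s.card →
        (girgLaw n β w₀ d).real (cliqueEvent lam d s) ≤
          (C * (n : ℝ) ^ ((1 - β) / 2)) ^ s.card := by
  have γ_pos : 0 < β - 1 := by linarith
  -- Any `η` with `3 * η ≤ β - 1` and `3 * η < 3 - β` would do: the exponent
  -- `(β - 1 + η) - (β - 1 - η) / 2` of a pair is then less than `1`.
  set η := (β - 1) * (3 - β) / 12 with hη
  have η_pos : 0 < η := by
    have : 0 < 3 - β := by linarith
    positivity
  have three_η_le : 3 * η ≤ β - 1 := by nlinarith
  have three_η_lt : 3 * η < 3 - β := by nlinarith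
  set τ := (1 - (β - 1 + 3 * η) / 2) / 14 with hτ
  have τ_pos : 0 < τ := by linarith
  refine ⟨2 / τ, (β - 1) * w₀ ^ (β - 1) * (2 / η) * lam ^ ((β - 1) / 2), by positivity, ?_⟩
  filter_upwards [eventually_one_le_and_neg_log_div_le (c := lam * (w₀ * w₀)) (by positivity) τ_pos,
    eventually_gt_atTop 0] with n large n_pos d hd s hs
  obtain ⟨d_ge_one, log_le⟩ := large d hd
  refine ENNReal.toReal_le_of_le_ofReal (by positivity) ?_
  rw [ENNReal.ofReal_pow (by positivity)]
  refine measure_cliqueEvent_le_pow hβ hw₀ (fun s hs hs' => ?_) hs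
  have pairs_le : ((orderedPairs s).card : ℝ) ≤ 25 := by
    exact_mod_cast card_orderedPairs_le.trans (Nat.pow_le_pow_left hs' 2)
  refine (measure_cliqueEvent_le_lintegral_min_pow (a := β - 1 + η) (b := β - 1 - η) hβ hlam hw₀
    n_pos d_ge_one τ_pos.le log_le (by linarith) (by linarith) (by nlinarith) hs).trans ?_
  refine pow_le_pow_left' ((lintegral_min_rpow_paretoMeasure_le hw₀ γ_pos η_pos
    (Real.sqrt_pos.2 (by positivity))).trans_eq ?_) _
  rw [sqrt_div_rpow_neg n.cast_nonneg hlam.le, ← mul_assoc]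

end CliqueEvent

section HeavyVertices

variable {β w₀ lam : ℝ} {n d : ℕ} {s : Finset (Fin n)}

/-- The attributes of a heavy vertex. The bound on the weight makes the connection threshold of two
heavy vertices at least `1 / 2`, the diameter of the torus. -/
def heavyVertices (lam : ℝ) (n d : ℕ) : Set (GIRGVertex d) :=
  {v | √(n / lam) ≤ v.1}

theorem measurableSet_heavyVertices : MeasurableSet (heavyVertices lam n d) :=
  measurableSet_le measurable_const measurable_fst

theorem measureReal_heavyVertices (hβ : 1 < β) (hw₀ : 0 < w₀) (hlam : 0 ≤ lam)
    (hn : w₀ ≤ √(n / lam)) :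
    (girgVertexLaw β w₀ d).real (heavyVertices lam n d) =
      w₀ ^ (β - 1) * lam ^ ((β - 1) / 2) * (n : ℝ) ^ ((1 - β) / 2) := by
  have := isProbabilityMeasure_paretoMeasure hw₀ (sub_pos.2 hβ)
  have eq_prod : heavyVertices lam n d = Set.Ici √(n / lam) ×ˢ Set.univ := by
    ext v
    simp [heavyVertices]
  rw [measureReal_def, eq_prod, girgVertexLaw, Measure.prod_prod, measure_univ, mul_one,
    paretoMeasure_Ici hw₀ (sub_pos.2 hβ) hn, ENNReal.toReal_ofReal (by positivity),
    sqrt_div_rpow_neg n.cast_nonneg hlam, mul_assoc]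

theorem dist_torus_le_half (x y : Fin d → UnitAddCircle) : dist x y ≤ 1 / 2 := by
  refine (dist_pi_le_iff (by norm_num)).2 fun i => ?_
  rw [dist_eq_norm]
  simpa using AddCircle.norm_le_half_period 1 one_ne_zero (x := x i - y i)

theorem half_le_connectionThreshold (hlam : 0 < lam) (hn : 0 < n) {a b : ℝ}
    (ha : √(n / lam) ≤ a) (hb : √(n / lam) ≤ b) : 1 / 2 ≤ connectionThreshold lam n d a b := by
  have : (0 : ℝ) < n := by exact_mod_cast hn
  have le_mul : n / lam ≤ a * b := by
    rw [← Real.mul_self_sqrt (by positivity : 0 ≤ n / lam)]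
    exact mul_le_mul ha hb (Real.sqrt_nonneg _) ((Real.sqrt_nonneg _).trans ha)
  have one_le : 1 ≤ lam * a * b / n := by
    rwa [one_le_div this, mul_assoc, ← div_le_iff₀' hlam]
  rw [connectionThreshold]
  linarith [Real.one_le_rpow one_le (by positivity : 0 ≤ 1 / (d : ℝ))]

theorem mem_cliqueEvent_of_forall_mem_heavyVertices (hlam : 0 < lam) (hn : 0 < n)
    {ω : Fin n → GIRGVertex d} (hω : ∀ i ∈ s, ω i ∈ heavyVertices lam n d) :
    ω ∈ cliqueEvent lam d s := by
  refine mem_cliqueEvent.2 fun e he => (dist_torus_le_half _ _).trans ?_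
  obtain ⟨he₁, he₂, -⟩ := mem_orderedPairs.1 he
  exact half_le_connectionThreshold hlam hn (hω _ he₁) (hω _ he₂)

theorem pow_le_measureReal_cliqueEvent (hβ : 1 < β) (hw₀ : 0 < w₀) (hlam : 0 < lam) (hn : 0 < n)
    (s : Finset (Fin n)) :
    (girgVertexLaw β w₀ d).real (heavyVertices lam n d) ^ s.card ≤
      (girgLaw n β w₀ d).real (cliqueEvent lam d s) := by
  have := isProbabilityMeasure_girgVertexLaw hβ hw₀ d
  have := isProbabilityMeasure_girgLaw hβ hw₀ n d
  calc (girgVertexLaw β w₀ d).real (heavyVertices lam n d) ^ s.card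
      = (girgLaw n β w₀ d).real ((s : Set (Fin n)).pi fun _ => heavyVertices lam n d) := by
        rw [girgLaw, measureReal_def, measureReal_def, Measure.pi_pi_finset, Finset.prod_const,
          ENNReal.toReal_pow]
    _ ≤ (girgLaw n β w₀ d).real (cliqueEvent lam d s) := measureReal_mono fun ω hω =>
        mem_cliqueEvent_of_forall_mem_heavyVertices hlam hn hω

theorem eventCount_heavyVertices_le_cliqueNum (hlam : 0 < lam) (hn : 0 < n)
    (ω : Fin n → GIRGVertex d) :
    eventCount Finset.univ (fun i => {ω : Fin n → GIRGVertex d | ω i ∈ heavyVertices lam n d}) ω ≤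
      (girgGraph lam ω).cliqueNum := by
  classical
  rw [eventCount_eq_card]
  have clique : ω ∈ cliqueEvent lam d (Finset.univ.filter fun i => ω i ∈ heavyVertices lam n d) :=
    mem_cliqueEvent_of_forall_mem_heavyVertices hlam hn fun i hi => (Finset.mem_filter.1 hi).2
  exact_mod_cast SimpleGraph.IsClique.card_le_cliqueNum (tc := clique)

theorem measureReal_cliqueNum_lt_le (hβ : 1 < β) (hw₀ : 0 < w₀) (hlam : 0 < lam) (hn : 0 < n)
    {p : ℝ} (hp : 0 < p) (heavy : (girgVertexLaw β w₀ d).real (heavyVertices lam n d) = p) :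
    (girgLaw n β w₀ d).real {ω | ((girgGraph lam ω).cliqueNum : ℝ) < n * p / 2} ≤ 4 / (n * p) := by
  have := isProbabilityMeasure_girgVertexLaw hβ hw₀ d
  have := isProbabilityMeasure_girgLaw hβ hw₀ n d
  set B : Fin n → Set (Fin n → GIRGVertex d) := fun i => {ω | ω i ∈ heavyVertices lam n d}
  have measurableSet_B (i) : MeasurableSet (B i) :=
    measurableSet_heavyVertices.preimage (measurable_pi_apply i)
  have prob_B (i) : (girgLaw n β w₀ d).real (B i) = p := by
    rw [← heavy]
    exact (measurePreserving_eval (fun _ => girgVertexLaw β w₀ d) i).measureReal_preimage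
      measurableSet_heavyVertices.nullMeasurableSet
  have sum_B : ∑ i, (girgLaw n β w₀ d).real (B i) = n * p := by
    simp [prob_B]
  have indep_B (i j) (hij : i ≠ j) : IndepSet (B i) (B j) (girgLaw n β w₀ d) := by
    rw [indepSet_iff_measure_inter_eq_mul (measurableSet_B i) (measurableSet_B j)
      (μ := girgLaw n β w₀ d)]
    exact (iIndepFun_eval_pi.indepFun hij).measure_inter_preimage_eq_mul _ _
      measurableSet_heavyVertices measurableSet_heavyVertices
  have chebyshev := measureReal_eventCount_lt_half_le (E := Finset.univ)
    (fun i _ => measurableSet_B i) (fun i _ j _ hij => indep_B i j hij) (by rw [sum_B]; positivity)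
  rw [sum_B] at chebyshev
  exact (measureReal_mono fun ω hω =>
    (eventCount_heavyVertices_le_cliqueNum hlam hn ω).trans_lt hω).trans chebyshev

end HeavyVertices

section ExpectedCliques

variable {β w₀ lam : ℝ} {n d k : ℕ}

theorem div_pow_le_choose (hkn : k ≤ n) : ((n : ℝ) / k) ^ k ≤ n.choose k := by
  induction k generalizing n with
  | zero => simp
  | succ k ih =>
    obtain ⟨m, rfl⟩ : ∃ m, n = m + 1 := ⟨n - 1, by omega⟩
    have succ_mul_choose : ((m + 1).choose (k + 1) : ℝ) =
        (m + 1 : ℕ) / (k + 1 : ℕ) * m.choose k := by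
      rw [div_mul_eq_mul_div, eq_div_iff (by positivity)]
      exact_mod_cast (Nat.add_one_mul_choose_eq m k).symm
    have hkm : (k : ℝ) ≤ m := by exact_mod_cast Nat.le_of_succ_le_succ hkn
    rw [succ_mul_choose, pow_succ']
    refine mul_le_mul_of_nonneg_left (le_trans ?_ (ih (Nat.le_of_succ_le_succ hkn)))
      (by positivity)
    rcases Nat.eq_zero_or_pos k with rfl | k_pos
    · simp
    · refine pow_le_pow_left₀ (by positivity) ?_ k
      rw [div_le_div_iff₀ (by positivity) (by exact_mod_cast k_pos)]
      push_cast
      linarith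

theorem choose_le_exp_mul_div_pow (hk : 0 < k) :
    (n.choose k : ℝ) ≤ (Real.exp 1 * n / k) ^ k := by
  have k_pos : (0 : ℝ) < k := by exact_mod_cast hk
  have pow_le : (k : ℝ) ^ k ≤ Real.exp k * k.factorial :=
    (div_le_iff₀ (by positivity)).1 (Real.pow_div_factorial_le_exp _ k_pos.le k)
  calc (n.choose k : ℝ) ≤ (n : ℝ) ^ k / k.factorial := Nat.choose_le_pow_div k n
    _ ≤ (n : ℝ) ^ k * Real.exp k / (k : ℝ) ^ k := by
        rw [div_le_div_iff₀ (by positivity) (by positivity), mul_assoc]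
        gcongr
    _ = (Real.exp 1 * n / k) ^ k := by
        rw [div_pow, mul_pow, ← Real.exp_nat_mul, mul_one, mul_comm (Real.exp k)]

theorem numCliques_eq_eventCount (ω : Fin n → GIRGVertex d) :
    (numCliques (girgGraph lam ω) k : ℝ) =
      eventCount (Finset.powersetCard k Finset.univ) (cliqueEvent lam d) ω := by
  classical
  rw [eventCount_eq_card, numCliques, ← Set.ncard_coe_finset]
  congr 2
  ext s
  rw [Finset.mem_coe, Finset.mem_filter, Finset.mem_powersetCard_univ, and_comm]
  exact SimpleGraph.isNClique_iff _

theorem expectedCliques_eq_sum (hβ : 1 < β) (hw₀ : 0 < w₀) :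
    expectedCliques lam β w₀ n d k = ∑ s ∈ Finset.powersetCard k (Finset.univ : Finset (Fin n)),
      (girgLaw n β w₀ d).real (cliqueEvent lam d s) := by
  have := isProbabilityMeasure_girgLaw hβ hw₀ n d
  simp only [expectedCliques, numCliques_eq_eventCount]
  exact integral_eventCount fun s _ => measurableSet_cliqueEvent

theorem expectedCliques_le_pow (hβ : 1 < β) (hw₀ : 0 < w₀) (hk : 0 < k) {q : ℝ} (hq₀ : 0 ≤ q)
    (hq : ∀ s : Finset (Fin n), s.card = k →
      (girgLaw n β w₀ d).real (cliqueEvent lam d s) ≤ q ^ k) :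
    expectedCliques lam β w₀ n d k ≤ (Real.exp 1 * (n * q) / k) ^ k := by
  rw [expectedCliques_eq_sum hβ hw₀]
  calc _ ≤ n.choose k * q ^ k := by
        simpa using Finset.sum_le_card_nsmul (Finset.powersetCard k Finset.univ) _ _ fun s hs =>
          hq s (Finset.mem_powersetCard_univ.1 hs)
    _ ≤ (Real.exp 1 * n / k) ^ k * q ^ k := by
        gcongr
        exact choose_le_exp_mul_div_pow hk
    _ = (Real.exp 1 * (n * q) / k) ^ k := by
        rw [← mul_pow]
        ring_nf

theorem pow_le_expectedCliques (hβ : 1 < β) (hw₀ : 0 < w₀) (hkn : k ≤ n) {q : ℝ} (hq₀ : 0 ≤ q)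
    (hq : ∀ s : Finset (Fin n), s.card = k →
      q ^ k ≤ (girgLaw n β w₀ d).real (cliqueEvent lam d s)) :
    (n * q / k) ^ k ≤ expectedCliques lam β w₀ n d k := by
  rw [expectedCliques_eq_sum hβ hw₀]
  calc (n * q / k) ^ k = (n / k : ℝ) ^ k * q ^ k := by
        rw [← mul_pow]
        ring_nf
    _ ≤ n.choose k * q ^ k := by
        gcongr
        exact div_pow_le_choose hkn
    _ ≤ _ := by
        simpa using Finset.card_nsmul_le_sum (Finset.powersetCard k Finset.univ) _ _ fun s hs =>
          hq s (Finset.mem_powersetCard_univ.1 hs)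

theorem measureReal_le_cliqueNum_le (hβ : 1 < β) (hw₀ : 0 < w₀) :
    (girgLaw n β w₀ d).real {ω | k ≤ (girgGraph lam ω).cliqueNum} ≤
      expectedCliques lam β w₀ n d k := by
  have := isProbabilityMeasure_girgLaw hβ hw₀ n d
  rw [expectedCliques_eq_sum hβ hw₀]
  refine (measureReal_mono (fun ω hω => ?_) (measure_ne_top _ _)).trans
    (measureReal_biUnion_finset_le _ _)
  obtain ⟨s, hs⟩ := (girgGraph lam ω).exists_isNClique_cliqueNum
  obtain ⟨t, hts, card_t⟩ := Finset.exists_subset_card_eq (hω.trans_eq hs.card_eq.symm)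
  exact Set.mem_biUnion (Finset.mem_powersetCard_univ.2 card_t)
    (cliqueEvent_subset hts hs.isClique)

end ExpectedCliques

theorem tendsto_measure_le_and_le_of_tendsto_measureReal_lt {ι : Type*} {Ω : ι → Type*}
    {mΩ : ∀ i, MeasurableSpace (Ω i)} {μ : ∀ i, Measure (Ω i)} [∀ i, IsProbabilityMeasure (μ i)]
    {l : Filter ι} {X : ∀ i, Ω i → ℝ} {a b : ι → ℝ}
    (lower : Tendsto (fun i => (μ i).real {ω | X i ω < a i}) l (𝓝 0))
    (upper : Tendsto (fun i => (μ i).real {ω | b i < X i ω}) l (𝓝 0)) :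
    Tendsto (fun i => μ i {ω | a i ≤ X i ω ∧ X i ω ≤ b i}) l (𝓝 1) := by
  rw [← ENNReal.tendsto_toReal_iff (fun i => measure_ne_top _ _) ENNReal.one_ne_top,
    ENNReal.toReal_one]
  refine tendsto_of_tendsto_of_tendsto_of_le_of_le (by simpa using (lower.add upper).const_sub 1)
    tendsto_const_nhds (fun i => ?_) fun i => measureReal_le_one
  have cover : (Set.univ : Set (Ω i)) ⊆
      {ω | a i ≤ X i ω ∧ X i ω ≤ b i} ∪ ({ω | X i ω < a i} ∪ {ω | b i < X i ω}) := fun ω _ => by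
    simp only [Set.mem_union, Set.mem_ofPred_eq]
    grind
  have one_le := ((measureReal_mono (μ := μ i) cover).trans (measureReal_union_le _ _)).trans
    (add_le_add_right (measureReal_union_le _ _) _)
  rw [probReal_univ] at one_le
  exact sub_le_iff_le_add.2 one_le

section Asymptotics

variable {β w₀ lam : ℝ}

theorem mul_const_mul_rpow {x : ℝ} (hx : 0 < x) (c : ℝ) :
    x * (c * x ^ ((1 - β) / 2)) = c * x ^ ((3 - β) / 2) := by
  rw [show (3 - β) / 2 = 1 + (1 - β) / 2 by ring, Real.rpow_add hx, Real.rpow_one]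
  ring

theorem rpow_mul_zpow_neg_eq {x : ℝ} (hx : 0 ≤ x) (c : ℝ) (k : ℕ) :
    x ^ ((k : ℝ) / 2 * (3 - β)) * (c * k) ^ (-(k : ℤ)) = (x ^ ((3 - β) / 2) / (c * k)) ^ k := by
  rw [div_pow, ← Real.rpow_mul_natCast hx, zpow_neg, zpow_natCast, div_eq_mul_inv]
  ring_nf

theorem tendsto_natCast_rpow_atTop {p : ℝ} (hp : 0 < p) :
    Tendsto (fun n : ℕ => (n : ℝ) ^ p) atTop atTop :=
  (tendsto_rpow_atTop hp).comp tendsto_natCast_atTop_atTop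

theorem eventually_mul_log_le {d : ℕ → ℕ}
    (hd : Tendsto (fun n : ℕ => (d n : ℝ) / Real.log n) atTop atTop) (D : ℝ) :
    ∀ᶠ n : ℕ in atTop, D * Real.log n ≤ d n := by
  filter_upwards [hd.eventually_ge_atTop D,
    (Real.tendsto_log_atTop.comp tendsto_natCast_atTop_atTop).eventually_gt_atTop 0]
    with n hn log_pos
  exact (le_div_iff₀ log_pos).1 hn

theorem exists_measureReal_heavyVertices_eq (hβ : 1 < β) (hw₀ : 0 < w₀) (hlam : 0 < lam) :
    ∃ c : ℝ, 0 < c ∧ ∀ᶠ n : ℕ in atTop, ∀ d : ℕ,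
      (girgVertexLaw β w₀ d).real (heavyVertices lam n d) = c * (n : ℝ) ^ ((1 - β) / 2) := by
  refine ⟨w₀ ^ (β - 1) * lam ^ ((β - 1) / 2), by positivity, ?_⟩
  filter_upwards [tendsto_natCast_atTop_atTop.eventually_ge_atTop (w₀ ^ 2 * lam)] with n hn d
  exact measureReal_heavyVertices hβ hw₀ hlam.le (Real.le_sqrt_of_sq_le ((le_div_iff₀ hlam).2 hn))

theorem exists_expectedCliques_le (hβ : 1 < β) (hβ' : β < 3) (hw₀ : 0 < w₀) (hlam : 0 < lam) :
    ∃ D c : ℝ, 0 < c ∧ ∀ᶠ n : ℕ in atTop, ∀ d : ℕ, D * Real.log n ≤ d → ∀ k : ℕ, 3 ≤ k →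
      expectedCliques lam β w₀ n d k ≤ ((n : ℝ) ^ ((3 - β) / 2) / (c * k)) ^ k := by
  obtain ⟨D, C, C_pos, clique_le⟩ := exists_measureReal_cliqueEvent_le hβ hβ' hw₀ hlam
  refine ⟨D, (Real.exp 1 * C)⁻¹, by positivity, ?_⟩
  filter_upwards [clique_le, eventually_gt_atTop 0] with n hn n_pos d hd k hk
  refine (expectedCliques_le_pow hβ hw₀ (by omega) (q := C * (n : ℝ) ^ ((1 - β) / 2))
    (by positivity) fun s hs => ?_).trans_eq ?_
  · rw [← hs]
    exact hn d hd s (hs ▸ hk)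
  · rw [mul_const_mul_rpow (by exact_mod_cast n_pos)]
    field_simp

theorem exists_le_expectedCliques (hβ : 1 < β) (hw₀ : 0 < w₀) (hlam : 0 < lam) :
    ∃ c : ℝ, 0 < c ∧ ∀ᶠ n : ℕ in atTop, ∀ d k : ℕ, k ≤ n →
      ((n : ℝ) ^ ((3 - β) / 2) / (c * k)) ^ k ≤ expectedCliques lam β w₀ n d k := by
  obtain ⟨c, c_pos, heavy⟩ := exists_measureReal_heavyVertices_eq hβ hw₀ hlam
  refine ⟨c⁻¹, by positivity, ?_⟩
  filter_upwards [heavy, eventually_gt_atTop 0] with n hn n_pos d k hkn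
  refine (le_of_eq ?_).trans (pow_le_expectedCliques hβ hw₀ hkn
    (q := c * (n : ℝ) ^ ((1 - β) / 2)) (by positivity) fun s hs => ?_)
  · rw [mul_const_mul_rpow (by exact_mod_cast n_pos)]
    field_simp
  · rw [← hs, ← hn d]
    exact pow_le_measureReal_cliqueEvent hβ hw₀ hlam n_pos s

theorem exists_tendsto_measureReal_cliqueNum_lt (hβ : 1 < β) (hβ' : β < 3) (hw₀ : 0 < w₀)
    (hlam : 0 < lam) :
    ∃ c : ℝ, 0 < c ∧ ∀ d : ℕ → ℕ, Tendsto (fun n : ℕ => (girgLaw n β w₀ (d n)).real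
      {ω | ((girgGraph lam ω).cliqueNum : ℝ) < c * (n : ℝ) ^ ((3 - β) / 2)}) atTop (𝓝 0) := by
  obtain ⟨c, c_pos, heavy⟩ := exists_measureReal_heavyVertices_eq hβ hw₀ hlam
  refine ⟨c / 2, by positivity, fun d => ?_⟩
  have size_tendsto := tendsto_natCast_rpow_atTop (p := (3 - β) / 2) (by linarith)
  refine squeeze_zero' (Eventually.of_forall fun n => measureReal_nonneg) ?_
    ((size_tendsto.const_mul_atTop c_pos).const_div_atTop 4)
  filter_upwards [heavy, eventually_gt_atTop 0] with n hn n_pos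
  have : (0 : ℝ) < n := by exact_mod_cast n_pos
  have few_heavy := measureReal_cliqueNum_lt_le hβ hw₀ hlam n_pos (by positivity) (hn (d n))
  rwa [mul_const_mul_rpow this, mul_div_right_comm] at few_heavy

theorem tendsto_measureReal_lt_cliqueNum (hβ : 1 < β) (hβ' : β < 3) (hw₀ : 0 < w₀) {c : ℝ}
    (hc : 0 < c) {d : ℕ → ℕ} (expectedCliques_le : ∀ᶠ n : ℕ in atTop, ∀ k : ℕ, 3 ≤ k →
      expectedCliques lam β w₀ n (d n) k ≤ ((n : ℝ) ^ ((3 - β) / 2) / (c * k)) ^ k) :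
    Tendsto (fun n : ℕ => (girgLaw n β w₀ (d n)).real
      {ω | 2 / c * (n : ℝ) ^ ((3 - β) / 2) < (girgGraph lam ω).cliqueNum}) atTop (𝓝 0) := by
  set k : ℕ → ℕ := fun n => ⌊2 / c * (n : ℝ) ^ ((3 - β) / 2)⌋₊ + 1
  have k_tendsto : Tendsto k atTop atTop :=
    (tendsto_add_atTop_nat 1).comp (tendsto_nat_floor_atTop.comp
      ((tendsto_natCast_rpow_atTop (by linarith)).const_mul_atTop (div_pos two_pos hc)))
  have half_pow_tendsto : Tendsto (fun n => (1 / 2 : ℝ) ^ k n) atTop (𝓝 0) :=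
    (tendsto_pow_atTop_nhds_zero_of_lt_one (by norm_num) (by norm_num)).comp k_tendsto
  refine squeeze_zero' (Eventually.of_forall fun n => measureReal_nonneg) ?_ half_pow_tendsto
  filter_upwards [expectedCliques_le, k_tendsto.eventually_ge_atTop 3] with n hn three_le_k
  have := isProbabilityMeasure_girgLaw hβ hw₀ n (d n)
  have lt_k : 2 / c * (n : ℝ) ^ ((3 - β) / 2) < k n := by
    exact_mod_cast Nat.lt_floor_add_one _
  have ratio_le : (n : ℝ) ^ ((3 - β) / 2) / (c * k n) ≤ 1 / 2 := by
    rw [div_mul_eq_mul_div, div_lt_iff₀ hc] at lt_k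
    exact div_le_of_le_mul₀ (by positivity) (by norm_num) (by linarith)
  calc (girgLaw n β w₀ (d n)).real
        {ω | 2 / c * (n : ℝ) ^ ((3 - β) / 2) < (girgGraph lam ω).cliqueNum}
      ≤ (girgLaw n β w₀ (d n)).real {ω | k n ≤ (girgGraph lam ω).cliqueNum} :=
        measureReal_mono fun ω hω => (Nat.floor_lt (by positivity)).2 hω
    _ ≤ expectedCliques lam β w₀ n (d n) (k n) := measureReal_le_cliqueNum_le hβ hw₀
    _ ≤ ((n : ℝ) ^ ((3 - β) / 2) / (c * k n)) ^ k n := hn (k n) three_le_k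
    _ ≤ (1 / 2) ^ k n := pow_le_pow_left₀ (by positivity) ratio_le _

end Asymptotics

theorem mainTheorem5_general (β w₀ lam : ℝ) (hβ : 1 < β) (hβ' : β < 3) (hw₀ : 0 < w₀)
    (hlam : 0 < lam) :
    ∃ D c₁ c₂ C₁ C₂ : ℝ, 0 < c₁ ∧ 0 < c₂ ∧ 0 < C₁ ∧ 0 < C₂ ∧
      ∀ d : ℕ → ℕ, (∀ᶠ n : ℕ in atTop, D * Real.log n ≤ d n) →
        (∀ᶠ n : ℕ in atTop, ∀ k : ℕ, 3 ≤ k → k ≤ n →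
          (n : ℝ) ^ ((k : ℝ) / 2 * (3 - β)) * (c₁ * k) ^ (-(k : ℤ))
              ≤ expectedCliques lam β w₀ n (d n) k ∧
          expectedCliques lam β w₀ n (d n) k
              ≤ (n : ℝ) ^ ((k : ℝ) / 2 * (3 - β)) * (c₂ * k) ^ (-(k : ℤ))) ∧
        Tendsto (fun n : ℕ => girgLaw n β w₀ (d n)
            {ω | C₁ * (n : ℝ) ^ ((3 - β) / 2) ≤ ((girgGraph lam ω).cliqueNum : ℝ) ∧
              ((girgGraph lam ω).cliqueNum : ℝ) ≤ C₂ * (n : ℝ) ^ ((3 - β) / 2)})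
          atTop (𝓝 1) := by
  obtain ⟨c₁, c₁_pos, le_expected⟩ := exists_le_expectedCliques hβ hw₀ hlam
  obtain ⟨D, c₂, c₂_pos, expected_le⟩ := exists_expectedCliques_le hβ hβ' hw₀ hlam
  obtain ⟨C₁, C₁_pos, cliqueNum_lt⟩ := exists_tendsto_measureReal_cliqueNum_lt hβ hβ' hw₀ hlam
  refine ⟨D, c₁, c₂, C₁, 2 / c₂, c₁_pos, c₂_pos, C₁_pos, by positivity, fun d hd => ?_⟩
  have expected_le := expected_le.mp (hd.mono fun n hn h => h (d n) hn)
  have (n : ℕ) := isProbabilityMeasure_girgLaw hβ hw₀ n (d n)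
  refine ⟨?_, tendsto_measure_le_and_le_of_tendsto_measureReal_lt (cliqueNum_lt d)
    (tendsto_measureReal_lt_cliqueNum hβ hβ' hw₀ c₂_pos expected_le)⟩
  filter_upwards [le_expected, expected_le] with n lower upper k hk hkn
  rw [rpow_mul_zpow_neg_eq n.cast_nonneg, rpow_mul_zpow_neg_eq n.cast_nonneg]
  exact ⟨lower (d n) k hkn, upper k hk⟩

theorem mainTheorem5 (β w₀ lam : ℝ) (hβ2 : 2 < β) (hβ3 : β < 3) (hw₀ : 0 < w₀) (hlam : 0 < lam) :
    (∃ c₁ c₂ : ℝ, 0 < c₁ ∧ 0 < c₂ ∧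
      ∀ d : ℕ → ℕ, Tendsto (fun n : ℕ => (d n : ℝ) / Real.log n) atTop atTop →
        ∀ᶠ n : ℕ in atTop, ∀ k : ℕ, 3 ≤ k → k ≤ n →
          (n : ℝ) ^ ((k : ℝ) / 2 * (3 - β)) * (c₁ * k) ^ (-(k : ℤ))
              ≤ expectedCliques lam β w₀ n (d n) k ∧
          expectedCliques lam β w₀ n (d n) k
              ≤ (n : ℝ) ^ ((k : ℝ) / 2 * (3 - β)) * (c₂ * k) ^ (-(k : ℤ))) ∧
    (∃ C₁ C₂ : ℝ, 0 < C₁ ∧ 0 < C₂ ∧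
      ∀ d : ℕ → ℕ, Tendsto (fun n : ℕ => (d n : ℝ) / Real.log n) atTop atTop →
        Tendsto (fun n : ℕ => girgLaw n β w₀ (d n)
            {ω | C₁ * (n : ℝ) ^ ((3 - β) / 2) ≤ ((girgGraph lam ω).cliqueNum : ℝ) ∧
              ((girgGraph lam ω).cliqueNum : ℝ) ≤ C₂ * (n : ℝ) ^ ((3 - β) / 2)})
          atTop (𝓝 1)) := by
  obtain ⟨D, c₁, c₂, C₁, C₂, hc₁, hc₂, hC₁, hC₂, general⟩ :=
    mainTheorem5_general β w₀ lam (by linarith) hβ3 hw₀ hlam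
  exact ⟨⟨c₁, c₂, hc₁, hc₂, fun d hd => (general d (eventually_mul_log_le hd D)).1⟩,
    ⟨C₁, C₂, hC₁, hC₂, fun d hd => (general d (eventually_mul_log_le hd D)).2⟩⟩
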